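/- Let $R$ be a commutative noetherian local ring that is Cohen–Macaulay (i.e. $\operatorname{depth} R=\dim R$) and generically Gorenstein (i.e. $R_{\mathfrak p}$ is a Gorenstein ring, that is, of finite injective dimension over itself, for every minimal prime $\mathfrak p$ of $R$), and let $\omega$ be a canonical module of $R$ (a finitely generated maximal Cohen–Macaulay $R$-module of type one and of finite injective dimension). Assume that $R$ satisfies the condition $(ES^R_1)$: every finitely generated $R$-module $X$ with $\operatorname{Ext}^i_R(X,R)=0$ for all $i>0$ satisfies $\operatorname{depth} X_{\mathfrak p}\ge \min\{1,\operatorname{depth} R_{\mathfrak p}\}$ for all prime ideals $\mathfrak p$ of $R$ (with $\operatorname{depth} 0=\infty$). If $\operatorname{Ext}^i_R(\omega,R)=0$ for all $i>0$, then $R$ is Gorenstein. -/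

import Mathlib

open CategoryTheory

universe u v

/-- The depth of a (finitely generated) module `M` over a local ring `R`: the supremum of the
lengths of the `M`-regular sequences in the maximal ideal. Weak regularity (the condition
`M ≠ (x₁, …, xₙ)M` is not imposed) is automatic regularity for nonzero finitely generated `M` over
a noetherian local ring, by Nakayama; for `M = 0` it gives the usual convention `depth 0 = ∞`. -/
noncomputable def moduleDepth (R : Type u) [CommRing R] [IsLocalRing R]
    (M : Type v) [AddCommGroup M] [Module R M] : ℕ∞ :=
  ⨆ (rs : List R) (_ : ∀ r ∈ rs, r ∈ IsLocalRing.maximalIdeal R)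
    (_ : RingTheory.Sequence.IsWeaklyRegular M rs), (rs.length : ℕ∞)

/-- `Ext^{>0}_R(M, N) = 0`. -/
def PosExtVanish (R : Type u) [CommRing R] (M N : Type u) [AddCommGroup M] [Module R M]
    [AddCommGroup N] [Module R N] : Prop :=
  ∀ i : ℕ, 0 < i → Subsingleton (Abelian.Ext (ModuleCat.of R M) (ModuleCat.of R N) i)

/-- The `R`-module `M` has finite injective dimension. -/
def HasFiniteInjDim (R : Type u) [CommRing R] (M : Type u) [AddCommGroup M] [Module R M] : Prop :=
  injectiveDimension (ModuleCat.of R M) ≠ ⊤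

/-- A noetherian local ring is Cohen-Macaulay if its depth equals its Krull dimension. -/
def IsCMLocalRing (R : Type u) [CommRing R] [IsLocalRing R] [IsNoetherianRing R] : Prop :=
  ((moduleDepth R R : ℕ∞) : WithBot ℕ∞) = ringKrullDim R

/-- A noetherian local ring is Gorenstein if it has finite injective dimension over itself. -/
def IsGorensteinLocalRing (R : Type u) [CommRing R] [IsLocalRing R] [IsNoetherianRing R] : Prop :=
  HasFiniteInjDim R R

/-- `R` is generically Gorenstein: `R_𝔭` is Gorenstein for each minimal prime `𝔭`. -/
def IsGenericallyGorenstein (R : Type u) [CommRing R] [IsNoetherianRing R] : Prop :=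
  ∀ (p : Ideal R) [p.IsPrime], p ∈ minimalPrimes R →
    IsGorensteinLocalRing (Localization.AtPrime p)

/-- The type of a finitely generated module `M` over a noetherian local ring with residue field
`k`: the `k`-dimension of `Ext^t(k, M)`, `t = depth M`. As the maximal ideal annihilates this
module, its `k`-dimension is its length over `R`. (Only meaningful for finite depth.) -/
noncomputable def moduleType (R : Type u) [CommRing R] [IsLocalRing R]
    (M : Type u) [AddCommGroup M] [Module R M] : ℕ∞ :=
  Module.length R (Abelian.Ext (ModuleCat.of R (IsLocalRing.ResidueField R)) (ModuleCat.of R M)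
    (moduleDepth R M).toNat)

/-- A canonical module of a Cohen-Macaulay local ring `R`: a maximal Cohen-Macaulay module of
type one and of finite injective dimension. -/
structure IsCanonicalModule (R : Type u) [CommRing R] [IsLocalRing R] [IsNoetherianRing R]
    (ω : Type u) [AddCommGroup ω] [Module R ω] : Prop where
  finite : Module.Finite R ω
  depth_eq : ((moduleDepth R ω : ℕ∞) : WithBot ℕ∞) = ringKrullDim R
  type_eq_one : moduleType R ω = 1
  finite_injDim : HasFiniteInjDim R ω

/-- The condition `(S̃_n)` on `M`: `depth M_𝔭 ≥ min {n, depth R_𝔭}` for each prime `𝔭`. -/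
def SatisfiesSTilde (R : Type u) [CommRing R] (n : ℕ) (M : Type v) [AddCommGroup M]
    [Module R M] : Prop :=
  ∀ (p : Ideal R) [p.IsPrime],
    min (n : ℕ∞) (moduleDepth (Localization.AtPrime p) (Localization.AtPrime p)) ≤
      moduleDepth (Localization.AtPrime p) (LocalizedModule p.primeCompl M)

/-- The condition `(ES_n^C)` on `R`: each finitely generated `R`-module `X` with
`Ext^{>0}_R(X, C) = 0` satisfies `(S̃_n)`. -/
def SatisfiesES (R : Type u) [CommRing R] (C : Type u) [AddCommGroup C] [Module R C]
    (n : ℕ) : Prop :=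
  ∀ (X : Type u) [AddCommGroup X] [Module R X] [Module.Finite R X],
    PosExtVanish R X C → SatisfiesSTilde R n X

/-! Call a finitely generated `X` good if `Ext^{>0}(X, R) = 0`. By `(ES_1)` and Cohen–Macaulayness
the associated primes of a good `X` are minimal primes of `R`. There `R_𝔭` is self-injective, which
yields enough maps to `R`: `X` is torsionless (`exists_linearMap_ne_zero`). Generators of `Hom(X,
R)` then embed `X` in a free module with good cokernel (`exists_left_approximation_injective`).
Iterating, dimension shifting gives `Ext^{>0}(X, W) = 0` for `W` of finite injective dimension
(`PosExtVanish.of_finite_injDim`). For `0 → ω → R^n → Y → 0` with `Y` good, `Ext^1(Y, ω) = 0`, so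
`ω` is a summand of `R^n`, hence free and nonzero; its summand `R` inherits finite injective
dimension. -/

section ExtSequences

/-! ### Long exact sequences of Ext in the first variable -/

variable {R : Type u} [CommRing R] {M N P : Type u} [AddCommGroup M] [Module R M]
  [AddCommGroup N] [Module R N] [AddCommGroup P] [Module R P]
  {f : M →ₗ[R] N} {g : N →ₗ[R] P}

theorem ModuleCat.shortExact_moduleCatMk (hf : Function.Injective f) (hg : Function.Surjective g)
    (h : Function.Exact f g) :
    (ShortComplex.moduleCatMk f g h.linearMap_comp_eq_zero).ShortExact where
  exact := by
    rw [ShortComplex.moduleCat_exact_iff]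
    exact fun x hx ↦ (h x).1 hx
  mono_f := (ModuleCat.mono_iff_injective _).2 hf
  epi_g := (ModuleCat.epi_iff_surjective _).2 hg

variable (Q : Type u) [AddCommGroup Q] [Module R Q]

theorem subsingleton_ext_middle (hf : Function.Injective f) (hg : Function.Surjective g)
    (h : Function.Exact f g) {n : ℕ}
    (h₁ : Subsingleton (Abelian.Ext (ModuleCat.of R M) (ModuleCat.of R Q) n))
    (h₃ : Subsingleton (Abelian.Ext (ModuleCat.of R P) (ModuleCat.of R Q) n)) :
    Subsingleton (Abelian.Ext (ModuleCat.of R N) (ModuleCat.of R Q) n) := by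
  refine subsingleton_of_forall_eq 0 fun x ↦ ?_
  obtain ⟨y, rfl⟩ := Abelian.Ext.contravariant_sequence_exact₂
    (ModuleCat.shortExact_moduleCatMk hf hg h) (ModuleCat.of R Q) x (h₁.elim _ _)
  rw [show y = 0 from h₃.elim _ _, Abelian.Ext.comp_zero]
  rfl

theorem subsingleton_ext_left (hf : Function.Injective f) (hg : Function.Surjective g)
    (h : Function.Exact f g) {n : ℕ}
    (h₂ : Subsingleton (Abelian.Ext (ModuleCat.of R N) (ModuleCat.of R Q) n))
    (h₃ : Subsingleton (Abelian.Ext (ModuleCat.of R P) (ModuleCat.of R Q) (n + 1))) :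
    Subsingleton (Abelian.Ext (ModuleCat.of R M) (ModuleCat.of R Q) n) := by
  refine subsingleton_of_forall_eq 0 fun x ↦ ?_
  obtain ⟨y, rfl⟩ := Abelian.Ext.contravariant_sequence_exact₁
    (ModuleCat.shortExact_moduleCatMk hf hg h) (ModuleCat.of R Q) x (add_comm 1 n) (h₃.elim _ _)
  rw [show y = 0 from h₂.elim _ _, Abelian.Ext.comp_zero]
  rfl

theorem subsingleton_ext_right (hf : Function.Injective f) (hg : Function.Surjective g)
    (h : Function.Exact f g) {n : ℕ}
    (h₁ : Subsingleton (Abelian.Ext (ModuleCat.of R M) (ModuleCat.of R Q) n))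
    (h₂ : Subsingleton (Abelian.Ext (ModuleCat.of R N) (ModuleCat.of R Q) (n + 1))) :
    Subsingleton (Abelian.Ext (ModuleCat.of R P) (ModuleCat.of R Q) (n + 1)) := by
  refine subsingleton_of_forall_eq 0 fun x ↦ ?_
  obtain ⟨y, rfl⟩ := Abelian.Ext.contravariant_sequence_exact₃
    (ModuleCat.shortExact_moduleCatMk hf hg h) (ModuleCat.of R Q) x (h₂.elim _ _) (add_comm 1 n)
  rw [show y = 0 from h₁.elim _ _, Abelian.Ext.comp_zero]
  rfl

variable {Q}

theorem exists_extension_of_subsingleton_ext_one (hf : Function.Injective f)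
    (hg : Function.Surjective g) (h : Function.Exact f g)
    (h₃ : Subsingleton (Abelian.Ext (ModuleCat.of R P) (ModuleCat.of R Q) 1)) (φ : M →ₗ[R] Q) :
    ∃ ψ : N →ₗ[R] Q, ψ ∘ₗ f = φ := by
  obtain ⟨y, hy⟩ := Abelian.Ext.contravariant_sequence_exact₁
    (ModuleCat.shortExact_moduleCatMk hf hg h) (ModuleCat.of R Q)
    (Abelian.Ext.mk₀ (ModuleCat.ofHom φ)) (add_comm 1 0) (h₃.elim _ _)
  obtain ⟨ψ, rfl⟩ := (Abelian.Ext.mk₀_bijective _ _).2 y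
  rw [Abelian.Ext.mk₀_comp_mk₀] at hy
  exact ⟨ψ.hom, congrArg ModuleCat.Hom.hom ((Abelian.Ext.mk₀_bijective _ _).1 hy)⟩

/-- Each class is the connecting image of some `φ : M → Q`; once `φ` extends over `f`, that image is
zero. -/
theorem subsingleton_ext_one_of_extension (hf : Function.Injective f)
    (hg : Function.Surjective g) (h : Function.Exact f g)
    (h₂ : Subsingleton (Abelian.Ext (ModuleCat.of R N) (ModuleCat.of R Q) 1))
    (hext : ∀ φ : M →ₗ[R] Q, ∃ ψ : N →ₗ[R] Q, ψ ∘ₗ f = φ) :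
    Subsingleton (Abelian.Ext (ModuleCat.of R P) (ModuleCat.of R Q) 1) := by
  have hS := ModuleCat.shortExact_moduleCatMk hf hg h
  refine subsingleton_of_forall_eq 0 fun x ↦ ?_
  obtain ⟨y, rfl⟩ := Abelian.Ext.contravariant_sequence_exact₃ hS (ModuleCat.of R Q) x
    (h₂.elim _ _) (add_comm 1 0)
  obtain ⟨φ, rfl⟩ := (Abelian.Ext.mk₀_bijective _ _).2 y
  obtain ⟨ψ, hψ⟩ := hext φ.hom
  let ψ' : (ShortComplex.moduleCatMk f g h.linearMap_comp_eq_zero).X₂ ⟶ ModuleCat.of R Q :=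
    ModuleCat.ofHom ψ
  have : φ = (ShortComplex.moduleCatMk f g h.linearMap_comp_eq_zero).f ≫ ψ' :=
    ModuleCat.hom_ext hψ.symm
  rw [this, ← Abelian.Ext.mk₀_comp_mk₀]
  exact hS.extClass_comp_assoc _

theorem subsingleton_ext_of_projective [Module.Projective R M] {n : ℕ} (hn : 0 < n) :
    Subsingleton (Abelian.Ext (ModuleCat.of R M) (ModuleCat.of R Q) n) := by
  obtain ⟨n, rfl⟩ := Nat.exists_eq_succ_of_ne_zero hn.ne'
  have := (IsProjective.iff_projective (R := R) M).1 ‹_›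
  exact Abelian.Ext.subsingleton_of_projective _ _ _

theorem subsingleton_ext_of_linearEquiv (e : M ≃ₗ[R] N) {n : ℕ}
    (h : Subsingleton (Abelian.Ext (ModuleCat.of R M) (ModuleCat.of R Q) n)) :
    Subsingleton (Abelian.Ext (ModuleCat.of R N) (ModuleCat.of R Q) n) := by
  refine subsingleton_of_forall_eq 0 fun x ↦ ?_
  rw [← Abelian.Ext.mk₀_id_comp x, show 𝟙 (ModuleCat.of R N) =
    ModuleCat.ofHom e.symm.toLinearMap ≫ ModuleCat.ofHom e.toLinearMap by ext; simp,
    ← Abelian.Ext.mk₀_comp_mk₀_assoc, h.elim ((Abelian.Ext.mk₀ _).comp x _) 0,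
    Abelian.Ext.comp_zero]

end ExtSequences

/-! ### Artinian Gorenstein local rings are self-injective -/

section SelfInjective

variable (A : Type u) [CommRing A] [IsLocalRing A] [IsNoetherianRing A]

theorem maximalIdeal_mem_associatedPrimes_of_krullDimLE_zero [Ring.KrullDimLE 0 A] :
    ∃ a : A, IsLocalRing.maximalIdeal A = Submodule.colon ⊥ {a} := by
  obtain ⟨q, hq⟩ := associatedPrimes.nonempty A A
  rw [AssociatedPrimes.mem_iff, isAssociatedPrime_iff] at hq
  obtain ⟨hq, a, ha⟩ := hq
  exact ⟨a, by rw [← ha, Ring.KrullDimLE.eq_maximalIdeal_of_isPrime q]⟩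

/-- Dévissage by prime filtrations: the only prime is the maximal ideal. -/
theorem subsingleton_ext_succ_of_residueField [Ring.KrullDimLE 0 A] {Q : Type u}
    [AddCommGroup Q] [Module A Q] {n : ℕ}
    (h : Subsingleton (Abelian.Ext (ModuleCat.of A (A ⧸ IsLocalRing.maximalIdeal A))
      (ModuleCat.of A Q) n))
    (M : Type u) [AddCommGroup M] [Module A M] [hM : Module.Finite A M] :
    Subsingleton (Abelian.Ext (ModuleCat.of A M) (ModuleCat.of A Q) n) := by
  induction hM using IsNoetherianRing.induction_on_isQuotientEquivQuotientPrime A with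
  | subsingleton N =>
    have : 𝟙 (ModuleCat.of A N) = 0 := by ext x; exact Subsingleton.elim (α := N) _ _
    refine subsingleton_of_forall_eq 0 fun x ↦ ?_
    rw [← Abelian.Ext.mk₀_id_comp x, this, Abelian.Ext.mk₀_zero, Abelian.Ext.zero_comp]
  | quotient N p e =>
    have := Ring.KrullDimLE.eq_maximalIdeal_of_isPrime p.1
    exact subsingleton_ext_of_linearEquiv
      ((Submodule.quotEquivOfEq _ _ this.symm).trans e.symm) h
  | exact N₁ N₂ N₃ f g hf hg hfg h₁ h₃ => exact subsingleton_ext_middle _ hf hg hfg h₁ h₃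

/-- The vanishing degree descends: the residue field `k` embeds in `A`, so `Ext^{n+1}(k, A)` is
controlled by `Ext^{n+2}(A/k, A) = 0`; dévissage does the rest. -/
theorem subsingleton_ext_one_of_finite_injDim [Ring.KrullDimLE 0 A] (n : ℕ)
    (h : ∀ (M : Type u) [AddCommGroup M] [Module A M] [Module.Finite A M],
      Subsingleton (Abelian.Ext (ModuleCat.of A M) (ModuleCat.of A A) (n + 1)))
    (M : Type u) [AddCommGroup M] [Module A M] [Module.Finite A M] :
    Subsingleton (Abelian.Ext (ModuleCat.of A M) (ModuleCat.of A A) 1) := by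
  induction n with
  | zero => exact h M
  | succ n ih =>
    refine ih fun M _ _ _ ↦ subsingleton_ext_succ_of_residueField A ?_ M
    obtain ⟨a, ha⟩ := maximalIdeal_mem_associatedPrimes_of_krullDimLE_zero A
    let f : (A ⧸ IsLocalRing.maximalIdeal A) →ₗ[A] A :=
      Submodule.liftQ _ (LinearMap.toSpanSingleton A A a) fun x hx ↦ by
        rw [ha, Submodule.mem_colon_singleton] at hx
        simpa using hx
    have hf : Function.Injective f := by
      rw [← LinearMap.ker_eq_bot]
      refine Submodule.ker_liftQ_eq_bot _ _ _ fun x hx ↦ ?_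
      rw [ha, Submodule.mem_colon_singleton]
      simpa using hx
    exact subsingleton_ext_left _ hf (Submodule.mkQ_surjective _)
      (LinearMap.exact_map_mkQ_range f)
      (subsingleton_ext_of_projective n.succ_pos) (h _)

theorem IsGorensteinLocalRing.injective [Ring.KrullDimLE 0 A] (h : IsGorensteinLocalRing A) :
    Module.Injective A A := by
  obtain ⟨n, hn⟩ := (injectiveDimension_ne_top_iff _).1 h
  have key := subsingleton_ext_one_of_finite_injDim A n fun M _ _ _ ↦
    subsingleton_of_forall_eq 0 fun e ↦
      e.eq_zero_of_hasInjectiveDimensionLT (n + 1) le_rfl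
  refine Module.Baer.injective fun I g ↦ ?_
  obtain ⟨ψ, hψ⟩ := exists_extension_of_subsingleton_ext_one I.injective_subtype
    (Submodule.mkQ_surjective I) (LinearMap.exact_subtype_mkQ I) (key _) g
  exact ⟨ψ, fun x hx ↦ LinearMap.congr_fun hψ ⟨x, hx⟩⟩

end SelfInjective

theorem one_le_moduleDepth_iff {R : Type u} [CommRing R] [IsLocalRing R] {M : Type v} [AddCommGroup M] [Module R M] :
    1 ≤ moduleDepth R M ↔ ∃ r ∈ IsLocalRing.maximalIdeal R, IsSMulRegular M r := by
  constructor
  · intro h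
    by_contra! hcon
    refine absurd h (not_le.2 (lt_of_le_of_lt (b := 0) ?_ one_pos))
    refine iSup_le fun rs ↦ iSup_le fun hrs ↦ iSup_le fun hreg ↦ ?_
    cases rs with
    | nil => simp
    | cons r rs =>
      exact absurd ((RingTheory.Sequence.isWeaklyRegular_cons_iff _ _ _).1 hreg).1
        (hcon r (hrs r (by simp)))
  · rintro ⟨r, hr, hreg⟩
    refine le_iSup_of_le [r] (le_iSup_of_le (by simpa using hr) (le_iSup_of_le ?_ (by simp)))
    simpa using hreg

/-! ### Cohen–Macaulay rings have no embedded primes -/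

section Unmixed

open scoped Pointwise

variable {R : Type u} [CommRing R] [IsLocalRing R] [IsNoetherianRing R]

theorem exists_associatedPrime_quotSMulTop {M : Type v} [AddCommGroup M] [Module R M]
    [Module.Finite R M] {p : Ideal R} (hp : IsAssociatedPrime p M) {r : R}
    (hr : r ∈ IsLocalRing.maximalIdeal R) (hreg : IsSMulRegular M r) :
    ∃ q : Ideal R, IsAssociatedPrime q (QuotSMulTop r M) ∧ p < q := by
  obtain ⟨hp', y, hy⟩ := isAssociatedPrime_iff.1 hp
  have hy0 : y ≠ 0 := by
    rintro rfl
    exact hp'.ne_top (by simp [hy])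
  let N : Submodule R M :=
    { carrier := {m | ∀ a ∈ p, a • m = 0}
      add_mem' := fun ha hb c hc ↦ by simp [ha c hc, hb c hc]
      zero_mem' := by simp
      smul_mem' := fun c m hm a ha ↦ by rw [smul_comm, hm a ha, smul_zero] }
  have hyN : y ∈ N := fun a ha ↦ by
    rw [hy, Submodule.mem_colon_singleton] at ha
    simpa using ha
  -- `N` is the part of `M` killed by `p`. If `N ≤ rM`, regularity of `r` gives `N = rN`, and
  -- Nakayama kills `N`, which contains `y ≠ 0`.
  have hnot : ¬ N ≤ r • (⊤ : Submodule R M) := by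
    intro hle
    have hN : N = ⊥ := by
      refine Submodule.eq_bot_of_le_smul_of_le_jacobson_bot (IsLocalRing.maximalIdeal R) N
        (IsNoetherian.noetherian N) (fun m hm ↦ ?_)
        (IsLocalRing.maximalIdeal_le_jacobson _)
      obtain ⟨m', -, rfl⟩ := (Submodule.mem_smul_pointwise_iff_exists _ _ _).1 (hle hm)
      refine Submodule.smul_mem_smul hr fun a ha ↦ hreg ?_
      simpa [smul_comm r a] using hm a ha
    rw [hN] at hyN
    exact hy0 (by simpa using hyN)
  obtain ⟨m, hm, hmr⟩ := SetLike.not_le_iff_exists.1 hnot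
  obtain ⟨q, hq, hle⟩ := exists_le_isAssociatedPrime_of_isNoetherianRing R
    (Submodule.Quotient.mk m : QuotSMulTop r M)
    (fun h ↦ hmr ((Submodule.Quotient.mk_eq_zero _).1 h))
  refine ⟨q, hq, lt_of_le_of_ne (fun a ha ↦ hle ?_) ?_⟩
  · rw [Submodule.mem_colon_singleton, Submodule.mem_bot, ← Submodule.Quotient.mk_smul, hm a ha,
      Submodule.Quotient.mk_zero]
  · rintro rfl
    have hrp : r ∈ p := hle (by
      rw [Submodule.mem_colon_singleton, Submodule.mem_bot, ← Submodule.Quotient.mk_smul,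
        Submodule.Quotient.mk_eq_zero]
      exact Submodule.smul_mem_pointwise_smul _ _ _ trivial)
    exact hy0 (hreg (by simpa using hyN r hrp))

/-- Each regular element allows a strictly larger associated prime, building a chain above `p`. -/
theorem length_le_coheight_of_isAssociatedPrime (rs : List R) {M : Type v} [AddCommGroup M]
    [Module R M] [Module.Finite R M] (hrs : ∀ r ∈ rs, r ∈ IsLocalRing.maximalIdeal R)
    (hreg : RingTheory.Sequence.IsWeaklyRegular M rs) (p : PrimeSpectrum R)
    (hp : IsAssociatedPrime p.asIdeal M) : (rs.length : ℕ∞) ≤ Order.coheight p := by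
  induction rs generalizing M p with
  | nil => simp
  | cons r rs ih =>
    rw [RingTheory.Sequence.isWeaklyRegular_cons_iff] at hreg
    obtain ⟨q, hq, hpq⟩ := exists_associatedPrime_quotSMulTop hp (hrs r (by simp)) hreg.1
    have hlt : p < ⟨q, hq.isPrime⟩ := hpq
    calc ((r :: rs).length : ℕ∞) = rs.length + 1 := by simp
      _ ≤ Order.coheight (⟨q, hq.isPrime⟩ : PrimeSpectrum R) + 1 := by
        gcongr
        exact ih (fun s hs ↦ hrs s (by simp [hs])) hreg.2 _ hq
      _ ≤ _ := Order.coheight_add_one_le hlt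

theorem moduleDepth_le_coheight {M : Type v} [AddCommGroup M] [Module R M] [Module.Finite R M]
    (p : PrimeSpectrum R) (hp : IsAssociatedPrime p.asIdeal M) :
    moduleDepth R M ≤ Order.coheight p :=
  iSup_le fun rs ↦ iSup_le fun h ↦ iSup_le fun hreg ↦
    length_le_coheight_of_isAssociatedPrime rs h hreg p hp

/-- Otherwise `depth R ≤ coheight p < coheight q ≤ dim R` for a minimal `q < p`. -/
theorem IsCMLocalRing.mem_minimalPrimes (hCM : IsCMLocalRing R) {p : Ideal R}
    (hp : IsAssociatedPrime p R) : p ∈ minimalPrimes R := by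
  have := hp.isPrime
  obtain ⟨q, hq, hqp⟩ := Ideal.exists_minimalPrimes_le (bot_le : ⊥ ≤ p)
  rcases hqp.eq_or_lt with rfl | hlt
  · exact hq
  have := hq.1.1
  have h₁ := moduleDepth_le_coheight ⟨p, hp.isPrime⟩ hp
  have h₂ : Order.coheight (⟨p, hp.isPrime⟩ : PrimeSpectrum R) + 1 ≤
    Order.coheight (⟨q, this⟩ : PrimeSpectrum R) := Order.coheight_add_one_le hlt
  have h₃ := Order.coheight_le_krullDim (⟨q, this⟩ : PrimeSpectrum R)
  have h₄ : ((moduleDepth R R + 1 : ℕ∞) : WithBot ℕ∞) ≤ (moduleDepth R R : ℕ∞) := by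
    rw [hCM]
    exact (WithBot.coe_le_coe.2 ((add_le_add_left h₁ 1).trans h₂)).trans h₃
  have h₅ : moduleDepth R R ≠ ⊤ := fun h ↦
    ringKrullDim_ne_top (R := R) (by rw [← hCM, h]; rfl)
  exact absurd (WithBot.coe_le_coe.1 h₄) (not_le.2 (ENat.lt_add_one_iff h₅ |>.2 le_rfl))

end Unmixed

/-! ### Behaviour at an associated prime -/

theorem moduleDepth_localizedModule_lt_one {R : Type u} [CommRing R] {X : Type v} [AddCommGroup X] [Module R X]
    {p : Ideal R} [p.IsPrime] {x : X} (hx : p = Submodule.colon ⊥ {x}) :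
    moduleDepth (Localization.AtPrime p) (LocalizedModule p.primeCompl X) < 1 := by
  rw [← not_le, one_le_moduleDepth_iff]
  rintro ⟨r, hr, hreg⟩
  induction r using Localization.induction_on with
  | H y =>
  obtain ⟨a, s⟩ := y
  have ha : a ∈ p := by
    rwa [Localization.mk_eq_mk', IsLocalization.AtPrime.mk'_mem_maximal_iff _ p] at hr
  have hax : a • x = 0 := by
    rw [hx, Submodule.mem_colon_singleton] at ha
    simpa using ha
  have h0 : LocalizedModule.mk x (1 : p.primeCompl) = 0 := hreg <| by
    simp only [smul_zero, LocalizedModule.mk_smul_mk, hax, LocalizedModule.zero_mk]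
  obtain ⟨t, ht⟩ := LocalizedModule.mk_eq.1 (h0.trans (LocalizedModule.zero_mk 1).symm)
  refine t.2 ?_
  have : (t : R) ∈ Submodule.colon ⊥ {x} := by
    rw [Submodule.mem_colon_singleton, Submodule.mem_bot]
    simpa [Submonoid.smul_def] using ht
  rwa [← hx] at this

theorem exists_linearMap_ne_zero_of_mem_minimalPrimes {R : Type u} [CommRing R]
    [IsNoetherianRing R] (hgen : IsGenericallyGorenstein R)
    {X : Type u} [AddCommGroup X] [Module R X] [Module.Finite R X] {p : Ideal R} [p.IsPrime]
    (hp : p ∈ minimalPrimes R) {x : X} (hx : p = Submodule.colon ⊥ {x}) :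
    ∃ f : X →ₗ[R] R, f x ≠ 0 := by
  let A := Localization.AtPrime p
  have : Ring.KrullDimLE 0 A := .of_isLocalization p hp A
  have : Module.Injective A A := IsGorensteinLocalRing.injective A (hgen p hp)
  obtain ⟨a, ha⟩ := maximalIdeal_mem_associatedPrimes_of_krullDimLE_zero A
  have ha0 : a ≠ 0 := by
    rintro rfl
    exact (IsLocalRing.maximalIdeal.isMaximal A).ne_top (by simp [ha])
  let x' : LocalizedModule p.primeCompl X := LocalizedModule.mk x 1
  have hann (c : A) (hc : c • x' = 0) : c • a = 0 := by
    suffices c ∈ IsLocalRing.maximalIdeal A by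
      rw [ha, Submodule.mem_colon_singleton] at this
      simpa using this
    induction c using Localization.induction_on with
    | H y =>
    obtain ⟨b, s⟩ := y
    rw [Localization.mk_eq_mk', IsLocalization.AtPrime.mk'_mem_maximal_iff _ p]
    rw [LocalizedModule.mk_smul_mk] at hc
    obtain ⟨t, ht⟩ := LocalizedModule.mk_eq.1 (hc.trans (LocalizedModule.zero_mk 1).symm)
    have : (t : R) * b ∈ p := by
      refine hx.ge (Submodule.mem_colon_singleton.2 ((Submodule.mem_bot R).2 ?_))
      simpa [Submonoid.smul_def, mul_smul] using ht
    exact (Ideal.IsPrime.mem_or_mem ‹p.IsPrime› this).resolve_left t.2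
  -- `x' ↦ a` is well defined since `ann x' ≤ 𝔪 = ann a`; injectivity extends it to `X_𝔭`, and
  -- finite presentation descends it to `X → R` up to a unit of `A`.
  let φ := LinearPMap.mkSpanSingleton' (σ := RingHom.id A) x' a hann
  obtain ⟨ψ, hψ⟩ := Module.Injective.out (R := A) (Q := A) φ.domain.subtype
    φ.domain.injective_subtype φ.toFun
  have hψa : ψ x' = a := by
    have hmem : x' ∈ φ.domain := Submodule.mem_span_singleton_self x'
    exact (hψ ⟨x', hmem⟩).trans (LinearPMap.mkSpanSingleton'_apply_self x' a hann hmem)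
  have := Module.finitePresentation_of_finite R X
  obtain ⟨f, s, hf⟩ := Module.FinitePresentation.exists_lift_of_isLocalizedModule p.primeCompl
    (Algebra.linearMap R A)
    (ψ.restrictScalars R ∘ₗ LocalizedModule.mkLinearMap p.primeCompl X)
  refine ⟨f, fun h0 ↦ ha0 ?_⟩
  have h1 := LinearMap.congr_fun hf x
  have h2 : (s : R) • a = 0 := by
    rw [← hψa]
    simpa [h0, x', Submonoid.smul_def] using h1.symm
  rw [Algebra.smul_def] at h2
  exact (IsLocalization.map_units A s).mul_right_eq_zero.1 h2

/-! ### Torsionlessness -/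

section Torsionless

variable {R : Type u} [CommRing R] [IsLocalRing R] [IsNoetherianRing R]

theorem SatisfiesSTilde.mem_minimalPrimes (hCM : IsCMLocalRing R) {X : Type v} [AddCommGroup X]
    [Module R X] (hX : SatisfiesSTilde R 1 X) {p : Ideal R} [p.IsPrime] {x : X}
    (hx : p = Submodule.colon ⊥ {x}) : p ∈ minimalPrimes R := by
  have h := (hX p).trans_lt (moduleDepth_localizedModule_lt_one hx)
  rw [Nat.cast_one, min_lt_iff, or_iff_right (lt_irrefl _), ← not_le,
    one_le_moduleDepth_iff] at h
  -- Now `depth R_𝔭 = 0`, so `p` consists of zero divisors; prime avoidance puts it in one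
  -- associated prime.
  have hsub : (p : Set R) ⊆ ⋃ q ∈ associatedPrimes R R, q := by
    intro r hr
    rw [biUnion_associatedPrimes_eq_compl_regular]
    intro hreg
    refine h ⟨algebraMap R _ r, ?_, ?_⟩
    · exact (IsLocalization.AtPrime.to_map_mem_maximal_iff _ p r).2 hr
    · exact IsSMulRegular.of_isLocalization (S := Localization.AtPrime p) p.primeCompl hreg
  obtain ⟨q, hq, hpq⟩ := (p.subset_union_prime_finite (associatedPrimes.finite R R)
    (f := id) 0 0 fun q hq _ _ ↦ hq.isPrime).1 hsub
  have hq' := hCM.mem_minimalPrimes hq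
  rwa [le_antisymm hpq (hq'.2 ⟨‹_›, bot_le⟩ hpq)]

theorem exists_linearMap_ne_zero (hCM : IsCMLocalRing R) (hgen : IsGenericallyGorenstein R)
    {X : Type u} [AddCommGroup X] [Module R X] [Module.Finite R X]
    (hX : SatisfiesSTilde R 1 X) {x : X} (hx : x ≠ 0) : ∃ f : X →ₗ[R] R, f x ≠ 0 := by
  -- Working in `Rx` makes `y` a multiple of `x`, so `f y ≠ 0` forces `f x ≠ 0`.
  obtain ⟨p, hp, -⟩ := exists_le_isAssociatedPrime_of_isNoetherianRing R
    (⟨x, Submodule.mem_span_singleton_self x⟩ : Submodule.span R {x}) (by simpa using hx)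
  obtain ⟨hp', ⟨y, hy⟩, hpy⟩ := isAssociatedPrime_iff.1 hp
  have hpy' : p = Submodule.colon ⊥ {y} := by
    rw [hpy]
    ext r
    simp [Submodule.mem_colon_singleton]
  obtain ⟨f, hf⟩ := exists_linearMap_ne_zero_of_mem_minimalPrimes hgen
    (hX.mem_minimalPrimes hCM hpy') hpy'
  obtain ⟨c, rfl⟩ := Submodule.mem_span_singleton.1 hy
  exact ⟨f, fun h ↦ hf (by simp [h])⟩

end Torsionless

/-! ### Embeddings into free modules and dimension shifting -/

section LeftApproximation

variable {R : Type u} [CommRing R] [IsNoetherianRing R]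

theorem exists_left_approximation (X : Type u) [AddCommGroup X] [Module R X] [Module.Finite R X] :
    ∃ (n : ℕ) (f : X →ₗ[R] (Fin n → R)),
      ∀ φ : X →ₗ[R] R, ∃ ψ : (Fin n → R) →ₗ[R] R, ψ ∘ₗ f = φ := by
  obtain ⟨n, s, hs⟩ := Module.Finite.exists_fin (R := R) (M := X →ₗ[R] R)
  refine ⟨n, LinearMap.pi s, fun φ ↦ ?_⟩
  obtain ⟨c, rfl⟩ := (Submodule.mem_span_range_iff_exists_fun R).1
    (hs ▸ Submodule.mem_top : φ ∈ Submodule.span R (Set.range s))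
  exact ⟨∑ i, c i • LinearMap.proj i, by ext x; simp⟩

theorem exists_left_approximation_injective (X : Type u) [AddCommGroup X] [Module R X]
    [Module.Finite R X] (hX : PosExtVanish R X R)
    (htl : ∀ x : X, x ≠ 0 → ∃ f : X →ₗ[R] R, f x ≠ 0) :
    ∃ (n : ℕ) (f : X →ₗ[R] (Fin n → R)), Function.Injective f ∧
      PosExtVanish R ((Fin n → R) ⧸ LinearMap.range f) R := by
  obtain ⟨n, f, hf⟩ := exists_left_approximation (R := R) X
  have hinj : Function.Injective f := by
    refine (injective_iff_map_eq_zero f).2 fun x hx ↦ ?_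
    by_contra hx0
    obtain ⟨φ, hφ⟩ := htl x hx0
    obtain ⟨ψ, rfl⟩ := hf φ
    exact hφ (by simp [hx])
  refine ⟨n, f, hinj, fun i hi ↦ ?_⟩
  have hsurj := Submodule.mkQ_surjective (LinearMap.range f)
  have hexact := LinearMap.exact_map_mkQ_range f
  obtain rfl | ⟨j, rfl⟩ : i = 1 ∨ ∃ j, i = j + 1 + 1 := by
    obtain ⟨j, rfl⟩ := Nat.exists_eq_succ_of_ne_zero hi.ne'
    cases j with
    | zero => exact .inl rfl
    | succ j => exact .inr ⟨j, rfl⟩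
  · exact subsingleton_ext_one_of_extension hinj hsurj hexact
      (subsingleton_ext_of_projective one_pos) hf
  · exact subsingleton_ext_right _ hinj hsurj hexact (hX _ j.succ_pos)
      (subsingleton_ext_of_projective (j + 1).succ_pos)

/-- If every finitely generated module with `Ext^{>0}(-, R) = 0` is torsionless, then such modules
are arbitrarily high syzygies of modules of the same kind, so `Ext^{>0}(-, W)` vanishes on them
for each `W` of finite injective dimension. -/
theorem PosExtVanish.of_finite_injDim
    (htl : ∀ (X : Type u) [AddCommGroup X] [Module R X] [Module.Finite R X],
      PosExtVanish R X R → ∀ x : X, x ≠ 0 → ∃ f : X →ₗ[R] R, f x ≠ 0)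
    {W : Type u} [AddCommGroup W] [Module R W] (hW : HasFiniteInjDim R W)
    {X : Type u} [AddCommGroup X] [Module R X] [Module.Finite R X] (hX : PosExtVanish R X R) :
    PosExtVanish R X W := by
  obtain ⟨N, hN⟩ := (injectiveDimension_ne_top_iff _).1 hW
  -- `k` counts the cokernels still to be taken; each raises the Ext degree by one, until it exceeds
  -- `N`.
  suffices ∀ (k : ℕ) (X : Type u) [AddCommGroup X] [Module R X] [Module.Finite R X],
      PosExtVanish R X R → ∀ i : ℕ, 0 < i → N + 1 ≤ i + k →
        Subsingleton (Abelian.Ext (ModuleCat.of R X) (ModuleCat.of R W) i) from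
    fun i hi ↦ this (N + 1) X hX i hi (by omega)
  intro k
  induction k with
  | zero =>
    exact fun X _ _ _ _ i _ hi ↦ subsingleton_of_forall_eq 0 fun e ↦
      e.eq_zero_of_hasInjectiveDimensionLT (N + 1) hi
  | succ k ih =>
    intro X _ _ _ hX i hi hik
    obtain ⟨n, f, hf, hY⟩ := exists_left_approximation_injective X hX (htl X hX)
    exact subsingleton_ext_left _ hf (Submodule.mkQ_surjective _)
      (LinearMap.exact_map_mkQ_range f) (subsingleton_ext_of_projective hi)
      (ih _ hY (i + 1) i.succ_pos (by omega))

end LeftApproximation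

/-! ### Splitting and conclusion -/

theorem HasFiniteInjDim.of_leftInverse {R : Type u} [CommRing R] {M N : Type u} [AddCommGroup M]
    [Module R M] [AddCommGroup N] [Module R N] (i : M →ₗ[R] N) (r : N →ₗ[R] M)
    (h : r ∘ₗ i = LinearMap.id) (hN : HasFiniteInjDim R N) : HasFiniteInjDim R M := by
  have e : Retract (ModuleCat.of R M) (ModuleCat.of R N) :=
    { i := ModuleCat.ofHom i
      r := ModuleCat.ofHom r
      retract := ModuleCat.hom_ext h }
  exact ne_top_of_le_ne_top hN e.injectiveDimension_le

theorem HasFiniteInjDim.self_of_free {R : Type u} [CommRing R] {M : Type u} [AddCommGroup M]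
    [Module R M] [Module.Free R M] [Nontrivial M] (hM : HasFiniteInjDim R M) :
    HasFiniteInjDim R R := by
  let b := Module.Free.chooseBasis R M
  obtain ⟨i⟩ := b.index_nonempty
  exact hM.of_leftInverse (LinearMap.toSpanSingleton R M (b i)) (b.coord i)
    (LinearMap.ext_ring (by simp))

theorem IsCanonicalModule.nontrivial {R : Type u} [CommRing R] [IsLocalRing R]
    [IsNoetherianRing R] {ω : Type u} [AddCommGroup ω] [Module R ω]
    (hω : IsCanonicalModule R ω) : Nontrivial ω := by
  by_contra hcon
  rw [not_nontrivial_iff_subsingleton] at hcon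
  have hdepth : moduleDepth R ω = ⊤ := by
    refine ENat.eq_top_iff_forall_ge.2 fun n ↦ ?_
    -- On the zero module even `0` is weakly regular, so depth is infinite, unlike the dimension.
    refine le_iSup_of_le (List.replicate n 0) (le_iSup_of_le ?_ (le_iSup_of_le ?_ (by simp)))
    · intro r hr
      rw [List.eq_of_mem_replicate hr]
      exact zero_mem _
    · exact ⟨fun i hi ↦ Function.injective_of_subsingleton _⟩
  exact ringKrullDim_ne_top (R := R) (by rw [← hω.depth_eq, hdepth]; rfl)

theorem corollary4p5 (R : Type u) [CommRing R] [IsLocalRing R] [IsNoetherianRing R]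
    (hCM : IsCMLocalRing R) (hgen : IsGenericallyGorenstein R)
    (ω : Type u) [AddCommGroup ω] [Module R ω] (hω : IsCanonicalModule R ω)
    (hES : SatisfiesES R R 1) (hExt : PosExtVanish R ω R) :
    IsGorensteinLocalRing R := by
  have := hω.finite
  have := hω.nontrivial
  have htl (X : Type u) [AddCommGroup X] [Module R X] [Module.Finite R X]
      (hX : PosExtVanish R X R) (x : X) (hx : x ≠ 0) : ∃ f : X →ₗ[R] R, f x ≠ 0 :=
    exists_linearMap_ne_zero hCM hgen (hES X hX) hx
  obtain ⟨n, f, hf, hY⟩ := exists_left_approximation_injective ω hExt (htl ω hExt)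
  -- Extending the identity of `ω` along `f` splits the embedding.
  obtain ⟨r, hr⟩ := exists_extension_of_subsingleton_ext_one hf (Submodule.mkQ_surjective _)
    (LinearMap.exact_map_mkQ_range f)
    (PosExtVanish.of_finite_injDim htl hω.finite_injDim hY 1 one_pos) LinearMap.id
  have := Module.Projective.of_split f r hr
  have : Module.Free R ω := Module.free_of_flat_of_isLocalRing
  exact hω.finite_injDim.self_of_free
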